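/- Let $F$ be an infinite field of characteristic different from $2$, and let $E=E_0\oplus E_1$ be the Grassmann algebra of an $F$-vector space of countably infinite dimension, with its natural $\mathbb{Z}_2$-grading. Let $$R=M_{1,1}(E)=\left\{\begin{pmatrix} a & b\\ c& d\end{pmatrix} : a,d\in E_0,\ b,c\in E_1\right\},$$ and let $W\subset R$ be the subspace of the matrices with supertrace $a-d$ equal to zero. Let $I_w$ be the ideal of the free associative algebra $F\langle x_1,x_2,\dots\rangle$ consisting of all polynomials that vanish under every substitution of elements of $W$ for the variables. For a two-rowed array of positive integers $S=\begin{bmatrix} a_1&\cdots&a_m\\ b_1&\cdots&b_m\end{bmatrix}$ put $f_S=[x_{a_1},x_{b_1}]\cdots[x_{a_m},x_{b_m}]$, where $[x,y]=xy-yx$. Call $S$ a *c-array* if $a_i>b_i$ for all $i$ and $(a_i,b_i)\le(a_{i+1},b_{i+1})$ in the (left) lexicographic order for all $i<m$. Call a c-array *normal* if moreover every integer occurs at most twice among its entries and there are no indices $r<s<t$ with $b_r\le b_s\le b_t$. Call $S$ *multilinear* if each of the integers $1,2,\dots,2m$ occurs exactly once among its entries. **Proposition 5.3.** For every $m\geq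 0$, the polynomials $f_S$, where $S$ runs over all multilinear normal c-arrays with $m$ columns, are linearly independent modulo $I_w$; that is, the family of their images is linearly independent over $F$ in $F\langle x_1,x_2,\dots\rangle/I_w$. -/

import Mathlib

/-! Weak polynomial identities of the superalgebra `M_{1,1}(E)` and normal c-arrays. -/

/-- The weak polynomial identities `I(R, W)`: the polynomials of the free associative algebra in
the variables `x_1, x_2, …` which vanish under every substitution of elements of `W ⊆ R` for the
variables. -/
def weakIdentities (F : Type*) [Field F] {R : Type*} [Ring R] [Algebra F R]
    (W : Submodule F R) : Submodule F (FreeAlgebra F ℕ+) where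
  carrier := {f | ∀ w : ℕ+ → R, (∀ i, w i ∈ W) → FreeAlgebra.lift F w f = 0}
  zero_mem' := fun w _ => map_zero _
  add_mem' := fun {f g} hf hg w hw => by rw [map_add, hf w hw, hg w hw, add_zero]
  smul_mem' := fun c f hf w hw => by rw [map_smul, hf w hw, smul_zero]

/-- `I(R, W)` is a two-sided ideal. -/
theorem mul_mem_weakIdentities {F : Type*} [Field F] {R : Type*} [Ring R] [Algebra F R]
    {W : Submodule F R} (g f h : FreeAlgebra F ℕ+) (hf : f ∈ weakIdentities F W) :
    g * f * h ∈ weakIdentities F W := fun w hw => by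
  rw [map_mul, map_mul, hf w hw, mul_zero, zero_mul]

/-- The Grassmann algebra `E` of a vector space of countably infinite dimension over `F`. -/
abbrev Grassmann (F : Type*) [Field F] : Type _ := ExteriorAlgebra F (ℕ →₀ F)

/-- The `ℤ/2`-homogeneous components `E_0` and `E_1` of the Grassmann algebra: `E_i` is spanned by
the products of `n` vectors with `n ≡ i` modulo 2. -/
noncomputable def grassmannPart (F : Type*) [Field F] (i : ZMod 2) : Submodule F (Grassmann F) :=
  CliffordAlgebra.evenOdd (0 : QuadraticForm F (ℕ →₀ F)) i

theorem mul_mem_grassmannPart {F : Type*} [Field F] {i j k : ZMod 2} (h : i + j = k)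
    {a b : Grassmann F} (ha : a ∈ grassmannPart F i) (hb : b ∈ grassmannPart F j) :
    a * b ∈ grassmannPart F k :=
  h ▸ CliffordAlgebra.evenOdd_mul_le _ i j (Submodule.mul_mem_mul ha hb)

theorem algebraMap_mem_grassmannPart {F : Type*} [Field F] (c : F) :
    algebraMap F (Grassmann F) c ∈ grassmannPart F 0 := by
  rw [Algebra.algebraMap_eq_smul_one]
  exact Submodule.smul_mem _ c
    (CliffordAlgebra.one_le_evenOdd_zero _ (Submodule.one_le.mp le_rfl))

/-- The superalgebra `M_{1,1}(E)` of the `2 × 2` matrices over `E` whose diagonal entries lie in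
`E_0` and whose off-diagonal entries lie in `E_1`. -/
noncomputable def M11 (F : Type*) [Field F] : Subalgebra F (Matrix (Fin 2) (Fin 2) (Grassmann F)) where
  carrier := {A | A 0 0 ∈ grassmannPart F 0 ∧ A 1 1 ∈ grassmannPart F 0 ∧
    A 0 1 ∈ grassmannPart F 1 ∧ A 1 0 ∈ grassmannPart F 1}
  mul_mem' := by
    rintro A B ⟨ha, hd, hb, hc⟩ ⟨ha', hd', hb', hc'⟩
    simp only [Set.mem_ofPred_eq, Matrix.mul_apply, Fin.sum_univ_two]
    exact ⟨add_mem (mul_mem_grassmannPart (by decide) ha ha')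
        (mul_mem_grassmannPart (by decide) hb hc'),
      add_mem (mul_mem_grassmannPart (by decide) hc hb')
        (mul_mem_grassmannPart (by decide) hd hd'),
      add_mem (mul_mem_grassmannPart (by decide) ha hb')
        (mul_mem_grassmannPart (by decide) hb hd'),
      add_mem (mul_mem_grassmannPart (by decide) hc ha')
        (mul_mem_grassmannPart (by decide) hd hc')⟩
  add_mem' := by
    rintro A B ⟨ha, hd, hb, hc⟩ ⟨ha', hd', hb', hc'⟩
    exact ⟨add_mem ha ha', add_mem hd hd', add_mem hb hb', add_mem hc hc'⟩
  algebraMap_mem' := fun c => by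
    simp [Matrix.algebraMap_matrix_apply, algebraMap_mem_grassmannPart]

/-- The supertrace `str(A) = a - d` of the matrix `A = (a, b; c, d)` of `M_{1,1}(E)`. -/
noncomputable def supertrace (F : Type*) [Field F] : M11 F →ₗ[F] Grassmann F where
  toFun A := A.1 0 0 - A.1 1 1
  map_add' A B := by simp; abel
  map_smul' c A := by simp [smul_sub]

/-- The subspace `W` of the matrices of `M_{1,1}(E)` with supertrace zero. -/
noncomputable def supertraceZero (F : Type*) [Field F] : Submodule F (M11 F) :=
  LinearMap.ker (supertrace F)

/-- The ideal `I_w` of the weak polynomial identities of the pair `(M_{1,1}(E), W)`. -/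
noncomputable def Iw (F : Type*) [Field F] : Submodule F (FreeAlgebra F ℕ+) :=
  weakIdentities F (supertraceZero F)

/-- A two-rowed array with `m` columns `(a_j, b_j)` of positive integers. -/
structure TwoRowedArray (m : ℕ) where
  a : Fin m → ℕ+
  b : Fin m → ℕ+

namespace TwoRowedArray

/-- The number of occurrences of the integer `i` in the array. -/
def content {m : ℕ} (S : TwoRowedArray m) (i : ℕ+) : ℕ :=
  (Finset.univ.filter fun j => S.a j = i).card + (Finset.univ.filter fun j => S.b j = i).card

/-- A c-array: `a_j > b_j` in every column, and the columns are sorted (weakly) in the left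
lexicographic order. -/
structure IsCArray {m : ℕ} (S : TwoRowedArray m) : Prop where
  b_lt_a : ∀ j, S.b j < S.a j
  sorted : Monotone fun j => toLex (S.a j, S.b j)

/-- A normal c-array: no integer occurs more than twice, and the second row has no weakly
increasing subsequence of length 3. -/
structure IsNormal {m : ℕ} (S : TwoRowedArray m) : Prop extends IsCArray S where
  content_le_two : ∀ i, S.content i ≤ 2
  no_increasing : ¬ ∃ r s t : Fin m, r < s ∧ s < t ∧ S.b r ≤ S.b s ∧ S.b s ≤ S.b t

/-- The proper polynomial `f_S = [x_{a_1}, x_{b_1}] ⋯ [x_{a_m}, x_{b_m}]`. -/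
def poly (F : Type*) [Field F] {m : ℕ} (S : TwoRowedArray m) : FreeAlgebra F ℕ+ :=
  (List.ofFn fun j => ⁅FreeAlgebra.ι F (S.a j), FreeAlgebra.ι F (S.b j)⁆).prod

end TwoRowedArray

/-- The set of normal c-arrays with `m` columns and content `n`. -/
def normalCArrays (m : ℕ) (n : ℕ+ → ℕ) : Set (TwoRowedArray m) :=
  {S | S.IsNormal ∧ S.content = n}

/-- The multilinear content `(1, …, 1)`, with `k` ones. -/
def multilinearContent (k : ℕ) (i : ℕ+) : ℕ := if (i : ℕ) ≤ k then 1 else 0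

/-! Substitute for x_i the matrix (0, e_i; c_i e_i, 0) of W, with c_i = ±1. Then [x_i, x_j] becomes
the scalar matrix (c_i + c_j) e_i e_j, so in the multilinear case f_T survives exactly when the
signs agree within every column of T. A normal S dictates a choice of signs: with no increasing
triple in the second row, its columns split into two classes on each of which the second row
decreases. As the first row increases, the columns of one class, viewed as arcs joining b to a, are
nested. Nesting makes S least, for a colexicographic order on the column-exchanging involutions,
among the arrays whose columns respect the classes (`lt_of_nested_involution`, `key_le_key`). In a
linear relation take S of greatest key among the terms with nonzero coefficient: its signs kill
every other term but not f_S. -/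

open ExteriorAlgebra in
/-- Products of distinct basis vectors do not vanish in the exterior algebra. -/
theorem prod_ofFn_ι_single_ne_zero (F : Type*) [Field F] {n : ℕ} {k : Fin n → ℕ}
    (hk : Function.Injective k) :
    (List.ofFn fun i => ι F (Finsupp.single (k i) (1 : F))).prod ≠ 0 := by
  intro h
  -- The minor on the coordinates `k i` is alternating, so it extends to the exterior algebra; it
  -- equals 1 on the given vectors.
  let g : (ℕ →₀ F) [⋀^Fin n]→ₗ[F] F :=
    Matrix.detRowAlternating.compLinearMap (LinearMap.pi fun i => Finsupp.lapply (k i))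
  have h1 : g (fun i => Finsupp.single (k i) (1 : F)) = 1 := by
    have : (fun i => (LinearMap.pi fun j => Finsupp.lapply (R := F) (M := F) (k j))
        (Finsupp.single (k i) (1 : F))) = (1 : Matrix (Fin n) (Fin n) F) := by
      ext i j
      simp [Finsupp.single_apply, Matrix.one_apply, hk.eq_iff]
    rw [AlternatingMap.compLinearMap_apply]
    exact (congrArg Matrix.det this).trans Matrix.det_one
  have h2 := liftAlternating_apply_ιMulti (Pi.single n g)
    (fun i => Finsupp.single (k i) (1 : F))
  rw [ιMulti_apply, h, map_zero, Pi.single_eq_same, h1] at h2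
  exact zero_ne_one h2

theorem prod_map_ι_single_ne_zero (F : Type*) [Field F] {l : List ℕ+} (hl : l.Nodup) :
    (l.map fun i : ℕ+ => ExteriorAlgebra.ι F (Finsupp.single (i : ℕ) (1 : F))).prod ≠ 0 := by
  nth_rw 1 [← List.ofFn_getElem (xs := l)]
  rw [List.map_ofFn]
  exact prod_ofFn_ι_single_ne_zero F (k := fun i : Fin l.length => ((l[i] : ℕ+) : ℕ))
    fun i j h => (List.nodup_iff_injective_get.mp hl) (PNat.coe_injective h)

theorem List.prod_ofFn_smul {R A : Type*} [CommSemiring R] [Semiring A] [Algebra R A] {m : ℕ}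
    (c : Fin m → R) (x : Fin m → A) :
    (List.ofFn fun j => c j • x j).prod = (∏ j, c j) • (List.ofFn x).prod := by
  induction m with
  | zero => simp
  | succ m ih =>
    rw [List.ofFn_succ, List.prod_cons, ih, List.ofFn_succ, List.prod_cons, Fin.prod_univ_succ,
      smul_mul_smul_comm]

/-! ### Evaluation at odd matrices -/

/-- The matrix `(0, e_i; c e_i, 0)` of `W`, where `e_i` is a basis vector. -/
noncomputable def oddMatrix (F : Type*) [Field F] (i : ℕ+) (c : F) : M11 F :=
  ⟨!![0, ExteriorAlgebra.ι F (Finsupp.single (i : ℕ) 1);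
      c • ExteriorAlgebra.ι F (Finsupp.single (i : ℕ) 1), 0],
    by
      have h : ExteriorAlgebra.ι F (Finsupp.single (i : ℕ) (1 : F)) ∈ grassmannPart F 1 :=
        CliffordAlgebra.ι_mem_evenOdd_one _ _
      exact ⟨zero_mem _, zero_mem _, h, Submodule.smul_mem _ c h⟩⟩

theorem oddMatrix_mem_supertraceZero (F : Type*) [Field F] (i : ℕ+) (c : F) :
    oddMatrix F i c ∈ supertraceZero F := by
  simp [supertraceZero, supertrace, oddMatrix]

/-- Commutators of the matrices `oddMatrix` are scalar. -/
theorem lie_oddMatrix (F : Type*) [Field F] (i j : ℕ+) (c d : F) :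
    ⁅(oddMatrix F i c).1, (oddMatrix F j d).1⁆ =
      Matrix.scalar (Fin 2) ((c + d) • (ExteriorAlgebra.ι F (Finsupp.single (i : ℕ) (1 : F)) *
        ExteriorAlgebra.ι F (Finsupp.single (j : ℕ) (1 : F)))) := by
  have h : ExteriorAlgebra.ι F (Finsupp.single (j : ℕ) (1 : F)) *
      ExteriorAlgebra.ι F (Finsupp.single (i : ℕ) (1 : F)) =
      -(ExteriorAlgebra.ι F (Finsupp.single (i : ℕ) (1 : F)) *
      ExteriorAlgebra.ι F (Finsupp.single (j : ℕ) (1 : F))) :=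
    eq_neg_of_add_eq_zero_left (ExteriorAlgebra.ι_add_mul_swap _ _)
  ext p q
  fin_cases p <;> fin_cases q <;>
    simp [oddMatrix, Ring.lie_def, h, add_smul, add_comm]

namespace TwoRowedArray

variable {m : ℕ}

/-- All the entries of an array, indexed by position. -/
def entry (S : TwoRowedArray m) : Fin m ⊕ Fin m → ℕ+ := Sum.elim S.a S.b

/-- The value of `f_S` at the matrices `oddMatrix`. -/
theorem lift_oddMatrix_poly (F : Type*) [Field F] (S : TwoRowedArray m) (c : ℕ+ → F) :
    (FreeAlgebra.lift F (fun i => oddMatrix F i (c i)) (S.poly F)).1 =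
      Matrix.scalar (Fin 2) ((∏ j, (c (S.a j) + c (S.b j))) • (List.ofFn fun j =>
        ExteriorAlgebra.ι F (Finsupp.single (S.a j : ℕ) (1 : F)) *
        ExteriorAlgebra.ι F (Finsupp.single (S.b j : ℕ) (1 : F))).prod) := by
  rw [← List.prod_ofFn_smul, map_list_prod, List.map_ofFn, poly, map_list_prod, List.map_ofFn]
  refine (map_list_prod (M11 F).val _).trans ?_
  rw [List.map_ofFn]
  congr 2
  funext j
  simp only [Function.comp_apply, ← lie_oddMatrix]
  simp [Ring.lie_def]

theorem prod_columns_ne_zero (F : Type*) [Field F] {S : TwoRowedArray m}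
    (hS : Function.Injective S.entry) :
    (List.ofFn fun j => ExteriorAlgebra.ι F (Finsupp.single (S.a j : ℕ) (1 : F)) *
      ExteriorAlgebra.ι F (Finsupp.single (S.b j : ℕ) (1 : F))).prod ≠ 0 := by
  have hnd : ((List.finRange m).flatMap fun j => [S.a j, S.b j]).Nodup := by
    rw [List.nodup_flatMap]
    refine ⟨fun j _ => ?_, (List.nodup_finRange m).imp fun {j k} hjk => ?_⟩
    · simpa using fun h => by simpa using @hS (.inl j) (.inr j) h
    · have h1 : S.a j ≠ S.a k := fun h => hjk (by simpa using @hS (.inl j) (.inl k) h)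
      have h2 : S.b j ≠ S.b k := fun h => hjk (by simpa using @hS (.inr j) (.inr k) h)
      have h3 : S.a j ≠ S.b k := fun h => by simpa using @hS (.inl j) (.inr k) h
      have h4 : S.b j ≠ S.a k := fun h => by simpa using @hS (.inr j) (.inl k) h
      simp [Function.onFun, h1.symm, h2.symm, h3.symm, h4.symm]
  have := prod_map_ι_single_ne_zero F hnd
  rw [List.map_flatMap, List.flatMap_def, List.prod_flatten, List.map_map] at this
  rw [List.ofFn_eq_map]
  simpa [Function.comp_def] using this

theorem content_eq_card (S : TwoRowedArray m) (i : ℕ+) :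
    S.content i = (Finset.univ.filter fun u => S.entry u = i).card := by
  simp only [content, Finset.card_filter, Fintype.sum_sum_type]
  rfl

theorem entry_injective {S : TwoRowedArray m} {k : ℕ} (h : S.content = multilinearContent k) :
    Function.Injective S.entry := by
  intro u v huv
  have h1 : (Finset.univ.filter fun w => S.entry w = S.entry v).card ≤ 1 := by
    rw [← content_eq_card, h, multilinearContent]
    split_ifs <;> simp
  exact Finset.card_le_one.mp h1 u (by simp [huv]) v (by simp)

theorem exists_entry_eq_iff {S : TwoRowedArray m} {k : ℕ} (h : S.content = multilinearContent k)
    {i : ℕ+} : (∃ u, S.entry u = i) ↔ (i : ℕ) ≤ k := by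
  have h1 := S.content_eq_card i
  rw [h, multilinearContent] at h1
  constructor
  · rintro ⟨u, hu⟩
    by_contra hi
    rw [if_neg hi, eq_comm, Finset.card_eq_zero] at h1
    exact Finset.notMem_empty u (h1 ▸ by simp [hu])
  · intro hi
    rw [if_pos hi] at h1
    obtain ⟨u, hu⟩ := Finset.card_pos.mp (h1 ▸ one_pos)
    exact ⟨u, by simpa using hu⟩

/-! ### The involution of an array -/

/-- The involution which exchanges the two entries of each column. -/
noncomputable def partner (S : TwoRowedArray m) : ℕ+ → ℕ+ :=
  Function.extend S.entry (S.entry ∘ Sum.swap) id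

theorem partner_entry {S : TwoRowedArray m} (hS : Function.Injective S.entry)
    (u : Fin m ⊕ Fin m) : S.partner (S.entry u) = S.entry u.swap :=
  hS.extend_apply _ _ u

theorem partner_of_notMem {S : TwoRowedArray m} {x : ℕ+} (hx : ¬ ∃ u, S.entry u = x) :
    S.partner x = x :=
  Function.extend_apply' _ _ _ hx

theorem partner_partner {S : TwoRowedArray m} (hS : Function.Injective S.entry) (x : ℕ+) :
    S.partner (S.partner x) = x := by
  by_cases hx : ∃ u, S.entry u = x
  · obtain ⟨u, rfl⟩ := hx
    rw [partner_entry hS, partner_entry hS, Sum.swap_swap]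
  · rw [partner_of_notMem hx, partner_of_notMem hx]

theorem partner_ne {S : TwoRowedArray m} (hS : Function.Injective S.entry) (u : Fin m ⊕ Fin m) :
    S.partner (S.entry u) ≠ S.entry u := by
  rw [partner_entry hS, hS.ne_iff]
  cases u <;> simp

theorem apply_partner {α : Type*} {S : TwoRowedArray m} (hS : Function.Injective S.entry)
    {χ : ℕ+ → α} (hχ : ∀ j, χ (S.a j) = χ (S.b j)) (x : ℕ+) : χ (S.partner x) = χ x := by
  by_cases hx : ∃ u, S.entry u = x
  · obtain ⟨u | u, rfl⟩ := hx
    · rw [partner_entry hS]; exact (hχ u).symm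
    · rw [partner_entry hS]; exact hχ u
  · rw [partner_of_notMem hx]

/-- The columns of a c-array with distinct entries are determined by its involution. -/
theorem range_columns {S : TwoRowedArray m} (hc : S.IsCArray)
    (hS : Function.Injective S.entry) :
    Set.range (fun j => toLex (S.a j, S.b j)) =
      {q | (ofLex q).2 < (ofLex q).1 ∧ S.partner (ofLex q).1 = (ofLex q).2} := by
  ext q
  constructor
  · rintro ⟨j, rfl⟩
    exact ⟨hc.b_lt_a j, partner_entry hS (.inl j)⟩
  · rintro ⟨h1, h2⟩
    by_cases hx : ∃ u, S.entry u = (ofLex q).1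
    · obtain ⟨j | j, hj⟩ := hx
      · rw [← hj, partner_entry hS] at h2
        exact ⟨j, congrArg toLex (Prod.ext hj h2)⟩
      · rw [← h2, ← hj, partner_entry hS] at h1
        exact absurd h1 (hc.b_lt_a j).not_gt
    · rw [partner_of_notMem hx] at h2
      exact absurd h2 h1.ne'

/-- The involution fixes the set of columns, and distinct entries make the sorting strict, which
fixes their order. -/
theorem eq_of_partner_eq {S T : TwoRowedArray m} (hS : S.IsCArray) (hT : T.IsCArray)
    (hSi : Function.Injective S.entry) (hTi : Function.Injective T.entry)
    (h : S.partner = T.partner) : S = T := by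
  have key {U : TwoRowedArray m} (hU : U.IsCArray) (hUi : Function.Injective U.entry) :
      StrictMono fun j => toLex (U.a j, U.b j) := by
    refine hU.sorted.strictMono_of_injective fun j k hjk => ?_
    simpa using @hUi (.inl j) (.inl k) (congrArg (fun q => (ofLex q).1) hjk)
  have h1 := ((key hS hSi).range_inj (key hT hTi)).mp
    (by rw [range_columns hS hSi, range_columns hT hTi, h])
  cases S
  cases T
  congr 1
  · exact funext fun j => congrArg (fun q => (ofLex q).1) (congrFun h1 j)
  · exact funext fun j => congrArg (fun q => (ofLex q).2) (congrFun h1 j)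

/-! ### The two nested classes of columns -/

open Classical in
/-- The column `j` contains the last element of an increasing pair of the second row. -/
noncomputable def columnClass (S : TwoRowedArray m) (j : Fin m) : Bool :=
  decide (∃ r < j, S.b r ≤ S.b j)

/-- The class of the column in which an integer occurs. -/
noncomputable def entryClass (S : TwoRowedArray m) : ℕ+ → Bool :=
  Function.extend S.entry (S.columnClass ∘ Sum.elim id id) fun _ => false

theorem entryClass_entry {S : TwoRowedArray m} (hS : Function.Injective S.entry)
    (u : Fin m ⊕ Fin m) : S.entryClass (S.entry u) = S.columnClass (u.elim id id) :=
  hS.extend_apply _ _ u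

/-- Each of the two classes of columns of a normal c-array is nested. -/
theorem partner_lt_partner {S : TwoRowedArray m} (hn : S.IsNormal)
    (hS : Function.Injective S.entry) {x y : ℕ+} (hxy : S.entryClass x = S.entryClass y)
    (hx : x < S.partner x) (hy : y < S.partner y) (h : x < y) : S.partner y < S.partner x := by
  -- Integers moved upwards are exactly the entries of the second row.
  have key {z : ℕ+} (hz : z < S.partner z) : ∃ j, S.entry (.inr j) = z := by
    by_cases hu : ∃ u, S.entry u = z
    · obtain ⟨j | j, rfl⟩ := hu
      · rw [partner_entry hS] at hz
        exact absurd hz (hn.b_lt_a j).not_gt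
      · exact ⟨j, rfl⟩
    · rw [partner_of_notMem hu] at hz
      exact absurd hz (lt_irrefl _)
  obtain ⟨j, rfl⟩ := key hx
  obtain ⟨k, rfl⟩ := key hy
  rw [partner_entry hS, partner_entry hS]
  rw [entryClass_entry hS, entryClass_entry hS] at hxy
  change S.b j < S.b k at h
  rcases lt_trichotomy j k with hjk | rfl | hjk
  · have hk : S.columnClass k = true := decide_eq_true ⟨j, hjk, h.le⟩
    obtain ⟨r, hr, hb⟩ := of_decide_eq_true (hxy.trans hk)
    exact absurd ⟨r, j, k, hr, hjk, hb, h.le⟩ hn.no_increasing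
  · exact absurd h (lt_irrefl _)
  · refine lt_of_le_of_ne ?_ fun h' => hjk.ne (by simpa using @hS (.inl k) (.inl j) h')
    have := hn.sorted hjk.le
    rw [Prod.Lex.toLex_le_toLex] at this
    exact this.elim le_of_lt fun h' => h'.1.le

/-! ### Minimality of nested involutions -/

/-- The involution of an array with entries `1, …, 2m`, ordered by the values at the largest
arguments first. -/
noncomputable def key (S : TwoRowedArray m) : Colex (Fin (2 * m) → ℕ+) :=
  toColex fun p => S.partner (Nat.succPNat p)

end TwoRowedArray

/-- A nested involution takes the smaller value at the largest argument where it differs from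
another involution with the same invariant classes. -/
theorem lt_of_nested_involution {α β : Type*} [LinearOrder α] {σ τ : α → α} {χ : α → β}
    (hσ : ∀ x, σ (σ x) = x) (hτ : ∀ x, τ (τ x) = x) (hσχ : ∀ x, χ (σ x) = χ x)
    (hτχ : ∀ x, χ (τ x) = χ x)
    (hnest : ∀ x y, χ x = χ y → x < σ x → y < σ y → x < y → σ y < σ x)
    {p : α} (hσp : ∀ x ≤ p, σ x ≠ x) (hτp : τ p ≠ p) (hgt : ∀ q > p, σ q = τ q)
    (hne : σ p ≠ τ p) : σ p < τ p := by
  -- A value above `p` would lie where the involutions agree, which forces agreement at `p` too.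
  have h1 : σ p < p := by
    refine lt_of_le_of_ne (not_lt.mp fun h => hne ?_) (hσp p le_rfl)
    rw [← hτ (σ p), ← hgt _ h, hσ]
  have h2 : τ p < p := by
    refine lt_of_le_of_ne (not_lt.mp fun h => hne ?_) hτp
    rw [← hσ (τ p), hgt _ h, hτ]
  by_contra h3
  have h4 : τ p < σ p := lt_of_le_of_ne (not_lt.mp h3) hne.symm
  have h5 : σ (τ p) < p := by
    refine lt_of_le_of_ne (not_lt.mp fun h => ?_) fun h => ?_
    · have h6 := hgt _ h
      rw [hσ] at h6
      have h7 : p = σ (τ p) := by rw [← hτ p, h6, hτ, ← h6]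
      exact h.ne h7
    · exact hne (by rw [← hσ (τ p), h])
  have h6 := hσp _ h2.le
  -- The arcs of `σ` through `τ p` and through `p` have the same class. The first opens below `σ p`
  -- and closes below `p`, so they are not nested.
  rcases lt_or_gt_of_ne h6 with h7 | h7
  · have := hnest (σ (τ p)) (σ p) (by simp only [hσχ, hτχ]) (by rwa [hσ]) (by rwa [hσ])
      (h7.trans h4)
    rw [hσ, hσ] at this
    exact this.not_gt h2
  · have := hnest (τ p) (σ p) (by simp only [hσχ, hτχ]) h7 (by rwa [hσ]) h4
    rw [hσ] at this
    exact this.not_gt h5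

namespace TwoRowedArray

variable {m : ℕ}

/-- A normal c-array has the least key among the arrays compatible with its classes. -/
theorem key_le_key {S T : TwoRowedArray m} (hn : S.IsNormal)
    (hS : S.content = multilinearContent (2 * m)) (hT : T.content = multilinearContent (2 * m))
    (hχ : ∀ j, S.entryClass (T.a j) = S.entryClass (T.b j)) : S.key ≤ T.key := by
  have hSi := entry_injective hS
  have hTi := entry_injective hT
  by_contra h
  obtain ⟨p, hp, hlt⟩ : ∃ p : Fin (2 * m), (∀ q : Fin (2 * m), p < q → T.key q = S.key q) ∧
    T.key p < S.key p := not_le.mp h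
  change T.partner (Nat.succPNat p) < S.partner (Nat.succPNat p) at hlt
  have hpk : ((Nat.succPNat p : ℕ+) : ℕ) ≤ 2 * m := p.2
  refine hlt.not_gt (lt_of_nested_involution (partner_partner hSi) (partner_partner hTi)
    (apply_partner hSi fun j => ?_) (apply_partner hTi hχ)
    (fun x y => partner_lt_partner hn hSi) (fun x hx => ?_) ?_ (fun q hq => ?_) hlt.ne')
  · exact (entryClass_entry hSi (.inl j)).trans (entryClass_entry hSi (.inr j)).symm
  · obtain ⟨u, rfl⟩ := (exists_entry_eq_iff hS).mpr (le_trans (PNat.coe_le_coe _ _ |>.mpr hx) hpk)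
    exact partner_ne hSi u
  · obtain ⟨u, hu⟩ := (exists_entry_eq_iff hT).mpr hpk
    exact hu ▸ partner_ne hTi u
  -- Index `q - 1` of the key stores the value at the integer `q`; beyond `2 * m` both involutions
  -- are the identity.
  · by_cases hqm : (q : ℕ) ≤ 2 * m
    · have hq' : (Nat.succPNat p : ℕ) < q := hq
      rw [Nat.succPNat_coe] at hq'
      have h1 := hp ⟨(q : ℕ) - 1, by omega⟩ (Fin.lt_def.mpr (by simp only; omega))
      have h2 : Nat.succPNat ((q : ℕ) - 1) = q := PNat.succPNat_natPred q
      change T.partner (Nat.succPNat ((q : ℕ) - 1)) = S.partner (Nat.succPNat ((q : ℕ) - 1)) at h1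
      rw [h2] at h1
      exact h1.symm
    · rw [partner_of_notMem (mt (exists_entry_eq_iff hS).mp hqm),
        partner_of_notMem (mt (exists_entry_eq_iff hT).mp hqm)]

theorem eq_of_key_eq {S T : TwoRowedArray m} (hSc : S.IsCArray) (hTc : T.IsCArray)
    (hS : S.content = multilinearContent (2 * m)) (hT : T.content = multilinearContent (2 * m))
    (h : S.key = T.key) : S = T := by
  refine eq_of_partner_eq hSc hTc (entry_injective hS) (entry_injective hT) (funext fun q => ?_)
  by_cases hqm : (q : ℕ) ≤ 2 * m
  · have h1 := congrFun h ⟨(q : ℕ) - 1, by have := q.pos; omega⟩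
    have h2 : Nat.succPNat ((q : ℕ) - 1) = q := PNat.succPNat_natPred q
    change S.partner (Nat.succPNat ((q : ℕ) - 1)) = T.partner (Nat.succPNat ((q : ℕ) - 1)) at h1
    rwa [h2] at h1
  · rw [partner_of_notMem (mt (exists_entry_eq_iff hS).mp hqm),
      partner_of_notMem (mt (exists_entry_eq_iff hT).mp hqm)]

end TwoRowedArray

theorem proposition5p3 (F : Type*) [Field F] [Infinite F] (hF : ringChar F ≠ 2) (m : ℕ) :
    LinearIndependent F
      (fun S : normalCArrays m (multilinearContent (2 * m)) =>
        (Iw F).mkQ (S.1.poly F)) := by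
  classical
  have h2 : (2 : F) ≠ 0 := Ring.two_ne_zero hF
  rw [linearIndependent_iff']
  intro s g hg
  by_contra! hne
  obtain ⟨S₁, hS₁, hgS₁⟩ := hne
  obtain ⟨S, hSs, hmax⟩ := (s.filter fun S => g S ≠ 0).exists_max_image (fun S => S.1.key)
    ⟨S₁, by simp [hS₁, hgS₁]⟩
  obtain ⟨hSs, hgS⟩ := Finset.mem_filter.mp hSs
  -- Since 2 ≠ 0, two signs have nonzero sum exactly when they are equal.
  let c : ℕ+ → F := fun i => if S.1.entryClass i then 1 else -1
  have hc (i j : ℕ+) : c i + c j ≠ 0 ↔ S.1.entryClass i = S.1.entryClass j := by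
    have h2' : (-1 : F) + -1 ≠ 0 := by
      rw [← neg_add, one_add_one_eq_two]; exact neg_ne_zero.mpr h2
    cases hi : S.1.entryClass i <;> cases hj : S.1.entryClass j <;>
      simp [c, hi, hj, h2', one_add_one_eq_two, h2]
  have hmem : ∑ T ∈ s, g T • T.1.poly F ∈ Iw F := by
    rw [← Submodule.Quotient.mk_eq_zero, ← Submodule.mkQ_apply, map_sum]
    simpa only [map_smul] using hg
  have hev := congrArg Subtype.val
    (hmem (fun i => oddMatrix F i (c i)) fun i => oddMatrix_mem_supertraceZero F i (c i))
  rw [map_sum, Finset.sum_eq_single S _ (fun h => absurd hSs h), map_smul] at hev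
  · have hSi := TwoRowedArray.entry_injective S.2.2
    have h0 : g S • (FreeAlgebra.lift F (fun i => oddMatrix F i (c i)) (S.1.poly F)).1 = 0 := hev
    rw [TwoRowedArray.lift_oddMatrix_poly] at h0
    have h1 := (smul_eq_zero.mp h0).resolve_left hgS
    rw [← map_zero (Matrix.scalar (Fin 2)), Matrix.scalar_inj, smul_eq_zero] at h1
    refine h1.elim (Finset.prod_ne_zero_iff.mpr fun j _ => (hc _ _).mpr ?_)
      (TwoRowedArray.prod_columns_ne_zero F hSi)
    exact (TwoRowedArray.entryClass_entry hSi (.inl j)).trans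
      (TwoRowedArray.entryClass_entry hSi (.inr j)).symm
  · intro T hT hTS
    by_cases hgT : g T = 0
    · rw [hgT, zero_smul, map_zero]
    rw [map_smul]
    refine smul_eq_zero_of_right _ (Subtype.ext ?_)
    rw [TwoRowedArray.lift_oddMatrix_poly]
    suffices h : ∏ j, (c (T.1.a j) + c (T.1.b j)) = 0 by rw [h, zero_smul, map_zero]; rfl
    by_contra h
    -- A surviving `T` respects the classes of `S`, so its key is at least that of `S`; maximality
    -- then forces `T = S`.
    have hle := TwoRowedArray.key_le_key S.2.1 S.2.2 T.2.2
      fun j => (hc _ _).mp (Finset.prod_ne_zero_iff.mp h j (Finset.mem_univ j))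
    have hge := hmax T (Finset.mem_filter.mpr ⟨hT, hgT⟩)
    exact hTS (Subtype.ext (TwoRowedArray.eq_of_key_eq T.2.1.toIsCArray S.2.1.toIsCArray
      T.2.2 S.2.2 (le_antisymm hge hle)))
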